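/- Let $\mathbb X,\mathbb E,\mathbb Y$ be finite-dimensional Euclidean spaces, let $\Phi:\mathbb X\to\mathbb E$ and $K:\mathbb X\to\mathbb Y$ be linear operators with adjoints $\Phi^*,K^*$, and let $g:\mathbb Y\to\mathbb R\cup\{\infty\}$ be a proper lower semicontinuous convex function with subdifferential $\partial g$ and Fenchel conjugate $g^*$. For $(b,\mu,v)\in\mathbb E\times(0,\infty)\times\mathbb Y$ define the primal-dual solution mapping of the regularized least-squares problem $\min_{x}\frac1{2\mu}\|\Phi x-b\|^2+g(Kx+v)$ by $$\widetilde S_{LS}(b,\mu,v)=\Big\{(x,y)\in\mathbb X\times\mathbb Y:\ 0=K^*y+\tfrac1\mu\Phi^*(\Phi x-b),\quad v\in-Kx+\partial g^*(y)\Big\}.$$ A proper lower semicontinuous convex function $\varphi$ satisfies the quadratic growth condition at $u$ for $z\in\partial\varphi(u)$ if there are $c,\varepsilon>0$ with $$\varphi(u')\ \ge\ \varphi(u)+\langle z,u'-u\rangle+\tfrac c2\, d\big(u';(\partial\varphi)^{-1}(z)\big)^2\qquad\text{whenever }\|u'-u\|<\varepsilon .$$ It satisfies the primal-dual quadratic growth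 condition at $u$ for $z$ if, in addition, $\varphi^*$ satisfies the quadratic growth condition at $z$ for $u$. A set-valued mapping $S$ is isolated calm at $p$ for $q\in S(p)$ if there are $\ell>0$ and neighborhoods $U$ of $q$ and $V$ of $p$ such that $\|q'-q\|\le\ell\|p'-p\|$ for all $p'\in V$ and $q'\in S(p')\cap U$. For a closed convex set $\Omega$ and $\bar z\in\Omega$, $T_\Omega(\bar z)$ is the tangent cone, i.e. the set of all $w$ for which there are $t_k\downarrow0$ and $w_k\to w$ with $\bar z+t_kw_k\in\Omega$ for all $k$; $N_\Omega(\bar z)=\{v:\langle v,z-\bar z\rangle\le0\ \forall z\in\Omega\}$ is the normal cone; and $\operatorname{ri}\Omega$ is the relative interior. Let $\bar b\in\mathbb E$, $\bar\mu>0$ and $(\bar x,\bar y)\in\widetilde S_{LS}(\bar b,\bar\mu,0)$, and suppose that $g$ satisfies the primal-dual quadratic growth condition at $K\bar x$ for $\bar y$. Suppose moreover that at least one of the following conditions holds: (i) the set $\partial g^*(\bar y)$ is polyhedral and $\operatorname{Ker}K^*\cap T_{\partial g(K\bar x)}(\bar y)=\{0\}$; (ii) $\operatorname{Im}K\cap\operatorname{ri}(\partial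 g^*(\bar y))\ne\emptyset$ and $\operatorname{Ker}K^*\cap T_{\partial g(K\bar x)}(\bar y)=\{0\}$; (iii) $\operatorname{Ker}K^*\cap N_{\partial g^*(\bar y)}(K\bar x)=\{0\}$. Then $\widetilde S_{LS}$ is isolated calm at $(\bar b,\bar\mu,0)$ for $(\bar x,\bar y)$ if and only if $$\operatorname{Ker}\Phi\cap K^{-1}\big(T_{\partial g^*(\bar y)}(K\bar x)\big)=\{0\}.$$ -/

import Mathlib

open Set Filter Topology
open scoped InnerProductSpace

noncomputable section

namespace PDCalm

/-! ### Sets: tangent and normal cones, polyhedral sets -/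

section Cones

variable {F : Type*} [NormedAddCommGroup F] [InnerProductSpace ℝ F]

/-- The (Bouligand) tangent cone to `Ω` at `x`: the vectors `w` for which there are `t k ↓ 0` and
`u k → w` with `x + t k • u k ∈ Ω` for all `k`. -/
def tangentCone (Ω : Set F) (x : F) : Set F :=
  {w | ∃ (t : ℕ → ℝ) (u : ℕ → F), (∀ k, 0 < t k) ∧ Tendsto t atTop (𝓝 0) ∧
    Tendsto u atTop (𝓝 w) ∧ ∀ k, x + t k • u k ∈ Ω}

/-- The normal cone of convex analysis to `Ω` at a point `x` of `Ω`. -/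
def normalCone (Ω : Set F) (x : F) : Set F :=
  {v | ∀ u ∈ Ω, ⟪v, u - x⟫_ℝ ≤ 0}

/-- A polyhedral convex set: an intersection of finitely many closed half-spaces
(and the whole space, for no half-spaces). -/
def IsPolyhedral (Ω : Set F) : Prop :=
  ∃ (m : ℕ) (a : Fin m → F) (β : Fin m → ℝ), Ω = {x | ∀ i, ⟪a i, x⟫_ℝ ≤ β i}

end Cones

/-! ### Extended-real-valued convex functions -/

section Functions

variable {F : Type*} [NormedAddCommGroup F] [InnerProductSpace ℝ F]

/-- Proper: never `-∞`, and finite somewhere. -/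
def IsProper (φ : F → EReal) : Prop :=
  (∀ x, φ x ≠ ⊥) ∧ ∃ x, φ x ≠ ⊤

/-- Convex: the epigraph is a convex subset of `F × ℝ`. -/
def IsConvex (φ : F → EReal) : Prop :=
  Convex ℝ {p : F × ℝ | φ p.1 ≤ (p.2 : EReal)}

/-- The subdifferential `∂φ(x)` of a proper function. Since `⊤ - ⊤ = ⊥` in `EReal`, it is empty at
the points where `φ` is `+∞`. -/
def subdifferential (φ : F → EReal) (x : F) : Set F :=
  {v | ∀ u, ((⟪v, u - x⟫_ℝ : ℝ) : EReal) ≤ φ u - φ x}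

/-- The Fenchel conjugate `φ*`. -/
def conjugate (φ : F → EReal) (v : F) : EReal :=
  ⨆ x, (((⟪v, x⟫_ℝ : ℝ) : EReal) - φ x)

/-- The quadratic growth condition for `φ` at `x` for `v`, where `v ∈ ∂φ(x)`; the set
`(∂φ)⁻¹(v)` then contains `x`. -/
def QuadraticGrowth (φ : F → EReal) (x v : F) : Prop :=
  ∃ c > (0 : ℝ), ∃ ε > (0 : ℝ), ∀ u ∈ Metric.ball x ε,
    φ x + ((⟪v, u - x⟫_ℝ + c / 2 * Metric.infDist u {z | v ∈ subdifferential φ z} ^ 2 : ℝ) : EReal)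
      ≤ φ u

/-- The primal-dual quadratic growth condition for `φ` at `x` for `v`, where `v ∈ ∂φ(x)`. -/
def PrimalDualQuadraticGrowth (φ : F → EReal) (x v : F) : Prop :=
  QuadraticGrowth φ x v ∧ QuadraticGrowth (conjugate φ) v x

end Functions

/-! ### Isolated calmness -/

/-- A set-valued mapping `S : P ⇉ Z` is isolated calm at `p` for `z ∈ S p` if there are `ℓ > 0` and
neighbourhoods `U` of `z` and `V` of `p` with `‖z' - z‖ ≤ ℓ ‖p' - p‖` whenever `p' ∈ V` and
`z' ∈ S p' ∩ U`. On product spaces the norm is the maximum norm; it is equivalent to the Euclidean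
product norm, and the property does not change when the norms are replaced by equivalent ones. -/
def IsolatedCalm {P Z : Type*} [NormedAddCommGroup P] [NormedAddCommGroup Z]
    (S : P → Set Z) (p : P) (z : Z) : Prop :=
  z ∈ S p ∧ ∃ ℓ > (0 : ℝ), ∃ U ∈ 𝓝 z, ∃ V ∈ 𝓝 p,
    ∀ p' ∈ V, ∀ z' ∈ S p' ∩ U, ‖z' - z‖ ≤ ℓ * ‖p' - p‖

/-! ### The primal-dual system of the regularized least-squares problem -/

section LeastSquares

variable {X E F : Type*}
  [NormedAddCommGroup X] [InnerProductSpace ℝ X] [FiniteDimensional ℝ X]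
  [NormedAddCommGroup E] [InnerProductSpace ℝ E] [FiniteDimensional ℝ E]
  [NormedAddCommGroup F] [InnerProductSpace ℝ F] [FiniteDimensional ℝ F]

/-- The primal-dual solution mapping of
`min_x (1 / (2 μ)) ‖Φ x - b‖² + g (K x + v)`: for `p = (b, μ, v)` with `μ > 0`, the set of all
`(x, y)` such that `0 = K* y + (1/μ) Φ* (Φ x - b)` and `v ∈ - K x + ∂g*(y)`.
Parameters with `μ ≤ 0` are outside the domain, and the mapping is empty there. -/
def primalDualSolution (Φ : X →ₗ[ℝ] E) (K : X →ₗ[ℝ] F) (g : F → EReal)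
    (p : E × ℝ × F) : Set (X × F) :=
  {z | 0 < p.2.1 ∧
    0 = LinearMap.adjoint K z.2 + (1 / p.2.1) • LinearMap.adjoint Φ (Φ z.1 - p.1) ∧
    ∃ s ∈ subdifferential (conjugate g) z.2, p.2.2 = -K z.1 + s}

end LeastSquares

end PDCalm

end

namespace PDCalm

/-! Isolated calmness is infinitesimal: it says that limit directions `(w, h)` of the graph over the
zero parameter direction vanish (`isolatedCalm_iff`). For such a direction the optimality equation
linearizes to `μ K*h + Φ*Φ w = 0`, and pairing with `w` gives `μ⟪h, K w⟫ + ‖Φ w‖² = 0`. Monotonicity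
of `∂g` gives `⟪h, K w⟫ ≥ 0`, so both terms vanish, whence `Φ w = 0` and `K*h = 0`. Quadratic growth
of `g` and of `g*` makes `K w` and `h` tangent to `∂g*(y)` and `∂g(K x)`
(`QuadraticGrowth.mem_tangentCone`). The kernel condition then kills `w`, and each of (i)-(iii)
kills `h`. Conversely, a nonzero `w` in the kernel set is a graph direction with `y` fixed, realized
by an `o(t)` perturbation of `v` alone. -/

lemma isClosed_epigraph {F : Type*} [TopologicalSpace F] {φ : F → EReal}
    (hφ : LowerSemicontinuous φ) :
    IsClosed {p : F × ℝ | φ p.1 ≤ (p.2 : EReal)} := by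
  have h := hφ.isClosed_epigraph
  exact h.preimage (f := fun p : F × ℝ => (p.1, (p.2 : EReal)))
    (continuous_fst.prodMk (continuous_coe_real_ereal.comp continuous_snd))

/-! ### Fenchel duality: `∂φ*` is the inverse of `∂φ`. -/

section ConvexDuality

variable {F : Type*} [NormedAddCommGroup F] [InnerProductSpace ℝ F]

lemma ne_top_of_mem_subdifferential {φ : F → EReal} {x v : F} (hv : v ∈ subdifferential φ x) :
    φ x ≠ ⊤ := by
  intro h
  have := hv x
  rw [h, EReal.sub_top] at this
  exact absurd this (not_le.2 (EReal.bot_lt_coe _))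

/-- The subgradient inequality between two points where the function is finite. -/
lemma subgradient_inequality {φ : F → EReal} {x v u : F} {r s : ℝ}
    (hv : v ∈ subdifferential φ x) (hx : φ x = r) (hu : φ u ≤ s) : r + ⟪v, u - x⟫_ℝ ≤ s := by
  have h : ((⟪v, u - x⟫_ℝ : ℝ) : EReal) ≤ s - r :=
    (hv u).trans (by rw [hx]; exact EReal.sub_le_sub hu le_rfl)
  have h' : ⟪v, u - x⟫_ℝ ≤ s - r := by exact_mod_cast h
  linarith

lemma exists_real_of_mem_subdifferential {φ : F → EReal} (hbot : ∀ x, φ x ≠ ⊥) {x v : F}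
    (hv : v ∈ subdifferential φ x) : ∃ r : ℝ, φ x = r :=
  ⟨(φ x).toReal, (EReal.coe_toReal (ne_top_of_mem_subdifferential hv) (hbot x)).symm⟩

lemma monotone_subdifferential {φ : F → EReal} (hbot : ∀ x, φ x ≠ ⊥) {x u v w : F}
    (hv : v ∈ subdifferential φ x) (hw : w ∈ subdifferential φ u) : 0 ≤ ⟪w - v, u - x⟫_ℝ := by
  obtain ⟨r, hr⟩ := exists_real_of_mem_subdifferential hbot hv
  obtain ⟨s, hs⟩ := exists_real_of_mem_subdifferential hbot hw
  have h₁ := subgradient_inequality hv hr hs.le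
  have h₂ := subgradient_inequality hw hs hr.le
  rw [← neg_sub u x, inner_neg_right] at h₂
  rw [inner_sub_left]
  linarith

lemma conjugate_ne_bot {φ : F → EReal} (hφ : IsProper φ) (v : F) : conjugate φ v ≠ ⊥ := by
  obtain ⟨x, hx⟩ := hφ.2
  have h : ((⟪v, x⟫_ℝ : ℝ) : EReal) - φ x ≤ conjugate φ v :=
    le_iSup (fun x => ((⟪v, x⟫_ℝ : ℝ) : EReal) - φ x) x
  lift φ x to ℝ using ⟨hx, hφ.1 x⟩ with r
  intro hbot
  rw [hbot, ← EReal.coe_sub] at h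
  exact absurd h (not_le.2 (EReal.bot_lt_coe _))

lemma conjugate_le_coe {φ : F → EReal} {v : F} {β : ℝ}
    (h : ∀ (z : F) (t : ℝ), φ z ≤ t → ⟪v, z⟫_ℝ - β ≤ t) (hbot : ∀ x, φ x ≠ ⊥) :
    conjugate φ v ≤ β := by
  refine iSup_le fun z => ?_
  rcases eq_or_ne (φ z) ⊤ with hz | hz
  · rw [hz, EReal.sub_top]; exact bot_le
  · have h' := h z (φ z).toReal (EReal.coe_toReal hz (hbot z)).ge
    rw [← EReal.coe_toReal hz (hbot z), ← EReal.coe_sub]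
    exact_mod_cast (by linarith : ⟪v, z⟫_ℝ - (φ z).toReal ≤ β)

lemma conjugate_ge {φ : F → EReal} {v z : F} {t s : ℝ} (hz : φ z ≤ t) (hs : conjugate φ v ≤ s) :
    ⟪v, z⟫_ℝ ≤ t + s := by
  have h : ((⟪v, z⟫_ℝ : ℝ) : EReal) - φ z ≤ conjugate φ v :=
    le_iSup (fun x => ((⟪v, x⟫_ℝ : ℝ) : EReal) - φ x) z
  have h' : ((⟪v, z⟫_ℝ : ℝ) : EReal) - t ≤ s := (EReal.sub_le_sub le_rfl hz).trans (h.trans hs)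
  have h'' : ⟪v, z⟫_ℝ - t ≤ s := by exact_mod_cast h'
  linarith

/-- Separation of a point from the epigraph of a closed convex function. -/
lemma exists_separating_pair [CompleteSpace F] {φ : F → EReal} (hφ : IsProper φ)
    (hlsc : LowerSemicontinuous φ) (hconv : IsConvex φ) {s : F} {r : ℝ} (hr : (r : EReal) < φ s) :
    ∃ (a : F) (α u : ℝ), 0 ≤ α ∧ ⟪a, s⟫_ℝ + α * r < u ∧
      ∀ (z : F) (t : ℝ), φ z ≤ t → u < ⟪a, z⟫_ℝ + α * t := by
  obtain ⟨f, u, hs, hu⟩ := geometric_hahn_banach_point_closed (x := (s, r)) hconv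
    (isClosed_epigraph hlsc) (by simpa using hr)
  set a := (InnerProductSpace.toDual ℝ F).symm (f.comp (ContinuousLinearMap.inl ℝ F ℝ)) with ha
  have hf : ∀ (z : F) (t : ℝ), f (z, t) = ⟪a, z⟫_ℝ + f (0, 1) * t := by
    intro z t
    have h₁ : ⟪a, z⟫_ℝ = f (z, 0) := by rw [ha, InnerProductSpace.toDual_symm_apply]; simp
    have h₂ : f (0, t) = f (0, 1) * t := by
      rw [mul_comm, ← smul_eq_mul, ← map_smul]; simp
    rw [h₁, ← h₂, ← map_add]; simp
  have hu' : ∀ (z : F) (t : ℝ), φ z ≤ t → u < ⟪a, z⟫_ℝ + f (0, 1) * t := fun z t h => by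
    rw [← hf]; exact hu (z, t) h
  refine ⟨a, f (0, 1), u, ?_, by rw [← hf]; exact hs, hu'⟩
  -- With a negative vertical coefficient, a point high enough above `x` in the epigraph would
  -- violate the separation.
  by_contra! hneg
  obtain ⟨x, hx⟩ := hφ.2
  set q := (φ x).toReal with hq
  have hxq : φ x = q := (EReal.coe_toReal hx (hφ.1 x)).symm
  set M := max q ((u - ⟪a, x⟫_ℝ) / f (0, 1)) with hM
  have h₁ := hu' x M (by rw [hxq]; exact_mod_cast le_max_left _ _)
  have h₂ : f (0, 1) * M ≤ f (0, 1) * ((u - ⟪a, x⟫_ℝ) / f (0, 1)) :=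
    mul_le_mul_of_nonpos_left (le_max_right _ _) hneg.le
  rw [mul_div_cancel₀ _ hneg.ne] at h₂
  linarith

/-- A non-vertical hyperplane is the graph of an affine function: divide by `α`. -/
lemma affine_minorant_of_pos {φ : F → EReal} {a s : F} {α u r : ℝ} (hα : 0 < α)
    (hs : ⟪a, s⟫_ℝ + α * r < u) (hu : ∀ (z : F) (t : ℝ), φ z ≤ t → u < ⟪a, z⟫_ℝ + α * t) :
    ∃ (v : F) (β : ℝ), r < ⟪v, s⟫_ℝ - β ∧ ∀ (z : F) (t : ℝ), φ z ≤ t → ⟪v, z⟫_ℝ - β ≤ t := by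
  refine ⟨(-α⁻¹) • a, -(α⁻¹ * u), ?_, fun z t h => ?_⟩
  · rw [real_inner_smul_left]
    have := mul_lt_mul_of_pos_left hs (inv_pos.2 hα)
    rw [mul_add, inv_mul_cancel_left₀ hα.ne'] at this
    linarith
  · rw [real_inner_smul_left]
    have := mul_lt_mul_of_pos_left (hu z t h) (inv_pos.2 hα)
    rw [mul_add, inv_mul_cancel_left₀ hα.ne'] at this
    linarith

/-- A proper lower semicontinuous convex function is the supremum of its affine minorants. -/
lemma exists_affine_minorant [CompleteSpace F] {φ : F → EReal} (hφ : IsProper φ)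
    (hlsc : LowerSemicontinuous φ) (hconv : IsConvex φ) {s : F} {r : ℝ} (hr : (r : EReal) < φ s) :
    ∃ (v : F) (β : ℝ), r < ⟪v, s⟫_ℝ - β ∧ ∀ (z : F) (t : ℝ), φ z ≤ t → ⟪v, z⟫_ℝ - β ≤ t := by
  obtain ⟨a, α, u, hα, hs, hu⟩ := exists_separating_pair hφ hlsc hconv hr
  rcases hα.lt_or_eq with hα | rfl
  · exact affine_minorant_of_pos hα hs hu
  -- Vertical case: `u - ⟪a, ·⟫` is negative on the domain and positive at `s`. A large multiple of
  -- it is added to some affine minorant, which exists because separation just below the graph at a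
  -- domain point cannot be vertical.
  · obtain ⟨x, hx⟩ := hφ.2
    have hxq : φ x = (φ x).toReal := (EReal.coe_toReal hx (hφ.1 x)).symm
    set q := (φ x).toReal
    obtain ⟨a₀, α₀, u₀, hα₀, hs₀, hu₀⟩ := exists_separating_pair hφ hlsc hconv (s := x)
      (r := q - 1) (by rw [hxq]; exact_mod_cast sub_one_lt q)
    have hpos : 0 < α₀ := by
      have := hu₀ x q hxq.le
      linarith
    obtain ⟨v, β, -, hv⟩ := affine_minorant_of_pos hpos hs₀ hu₀
    simp only [zero_mul, add_zero] at hs hu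
    obtain ⟨n, hn⟩ := exists_nat_gt ((r - (⟪v, s⟫_ℝ - β)) / (u - ⟪a, s⟫_ℝ))
    rw [div_lt_iff₀ (sub_pos.2 hs)] at hn
    refine ⟨v - (n : ℝ) • a, β - n * u, ?_, fun z t h => ?_⟩
    · rw [inner_sub_left, real_inner_smul_left]; linarith
    · rw [inner_sub_left, real_inner_smul_left]
      have h₁ := hv z t h
      have h₂ := mul_le_mul_of_nonneg_left (hu z t h).le (Nat.cast_nonneg (α := ℝ) n)
      linarith

/-- The subdifferential of the conjugate is the inverse of the subdifferential. -/
theorem mem_subdifferential_conjugate_iff [CompleteSpace F] {φ : F → EReal} (hφ : IsProper φ)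
    (hlsc : LowerSemicontinuous φ) (hconv : IsConvex φ) {s y : F} :
    s ∈ subdifferential (conjugate φ) y ↔ y ∈ subdifferential φ s := by
  constructor
  · intro h
    obtain ⟨c, hc⟩ := exists_real_of_mem_subdifferential (conjugate_ne_bot hφ) h
    have hle : φ s ≤ ((⟪y, s⟫_ℝ - c : ℝ) : EReal) := by
      -- Otherwise a minorant of slope `v` exceeds `⟪y, s⟫ - c` at `s`, against the subgradient
      -- inequality for the conjugate between `y` and `v`.
      by_contra! hlt
      obtain ⟨v, β, hr, hv⟩ := exists_affine_minorant hφ hlsc hconv hlt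
      have := subgradient_inequality h hc (conjugate_le_coe hv hφ.1)
      rw [inner_sub_right, real_inner_comm, real_inner_comm y] at this
      linarith
    have htop : φ s ≠ ⊤ := fun h => absurd (h ▸ hle) (not_le.2 (EReal.coe_lt_top _))
    have hq : φ s = (φ s).toReal := (EReal.coe_toReal htop (hφ.1 s)).symm
    set q := (φ s).toReal
    intro u
    rw [hq] at hle ⊢
    have hle' : q ≤ ⟪y, s⟫_ℝ - c := by exact_mod_cast hle
    rcases eq_or_ne (φ u) ⊤ with hu | hu
    · rw [hu, EReal.top_sub_coe]; exact le_top
    · have hu' := (EReal.coe_toReal hu (hφ.1 u)).symm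
      have := conjugate_ge hu'.le hc.le
      rw [hu', inner_sub_right]
      exact_mod_cast (by linarith : ⟪y, u⟫_ℝ - ⟪y, s⟫_ℝ ≤ (φ u).toReal - q)
  · intro h
    obtain ⟨q, hq⟩ := exists_real_of_mem_subdifferential hφ.1 h
    have hc : conjugate φ y ≤ ((⟪y, s⟫_ℝ - q : ℝ) : EReal) := by
      refine conjugate_le_coe (fun z t ht => ?_) hφ.1
      have := subgradient_inequality h hq ht
      rw [inner_sub_right] at this
      linarith
    have htop : conjugate φ y ≠ ⊤ := fun h => absurd (h ▸ hc) (not_le.2 (EReal.coe_lt_top _))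
    have hcr := (EReal.coe_toReal htop (conjugate_ne_bot hφ y)).symm
    intro v
    rw [hcr] at hc ⊢
    have hc' : (conjugate φ y).toReal ≤ ⟪y, s⟫_ℝ - q := by exact_mod_cast hc
    rcases eq_or_ne (conjugate φ v) ⊤ with hv | hv
    · rw [hv, EReal.top_sub_coe]; exact le_top
    · have hv' := (EReal.coe_toReal hv (conjugate_ne_bot hφ v)).symm
      have := conjugate_ge hq.le hv'.le
      rw [hv', inner_sub_right, real_inner_comm, real_inner_comm y s]
      exact_mod_cast
        (by linarith : ⟪v, s⟫_ℝ - ⟪y, s⟫_ℝ ≤ (conjugate φ v).toReal - (conjugate φ y).toReal)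

end ConvexDuality

/-! ### Quadratic growth and tangent directions. -/

section Tangents

variable {F : Type*} [NormedAddCommGroup F] [InnerProductSpace ℝ F]

lemma zero_mem_tangentCone {Ω : Set F} {x : F} (hx : x ∈ Ω) : (0 : F) ∈ tangentCone Ω x :=
  ⟨fun k => 1 / ((k : ℝ) + 1), fun _ => 0, fun _ => by positivity,
    tendsto_one_div_add_atTop_nhds_zero_nat, tendsto_const_nhds, fun _ => by simpa using hx⟩

lemma mem_tangentCone_of_infDist {Ω : Set F} (hΩ : Ω.Nonempty) {x w : F} {t : ℕ → ℝ} {d : ℕ → F}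
    (ht : ∀ k, 0 < t k) (ht₀ : Tendsto t atTop (𝓝 0)) (hd : Tendsto d atTop (𝓝 w))
    (hdist : Tendsto (fun k => Metric.infDist (x + t k • d k) Ω / t k) atTop (𝓝 0)) :
    w ∈ tangentCone Ω x := by
  -- Near-projections with error `o(t k)` suffice, so the distance need not be attained.
  have hex : ∀ k : ℕ, ∃ q ∈ Ω, dist (x + t k • d k) q <
      Metric.infDist (x + t k • d k) Ω + t k * (1 / ((k : ℝ) + 1)) := fun k =>
    (Metric.infDist_lt_iff hΩ).1 (lt_add_of_pos_right _ (mul_pos (ht k) (by positivity)))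
  choose q hq hdq using hex
  refine ⟨t, fun k => (t k)⁻¹ • (q k - x), ht, ht₀, ?_, fun k => ?_⟩
  · have hzero : Tendsto (fun k => (t k)⁻¹ • (q k - x) - d k) atTop (𝓝 0) := by
      refine squeeze_zero_norm (fun k => ?_)
        (by simpa only [add_zero] using
          hdist.add (tendsto_one_div_add_atTop_nhds_zero_nat (𝕜 := ℝ)))
      have hrw : (t k)⁻¹ • (q k - x) - d k = (t k)⁻¹ • (q k - (x + t k • d k)) := by
        rw [← sub_sub, smul_sub _ (q k - x), inv_smul_smul₀ (ht k).ne']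
      rw [hrw, norm_smul, Real.norm_of_nonneg (inv_pos.2 (ht k)).le, ← dist_eq_norm, dist_comm,
        inv_mul_le_iff₀ (ht k), mul_add, mul_div_cancel₀ _ (ht k).ne']
      exact (hdq k).le
    simpa using hzero.add hd
  · rw [smul_inv_smul₀ (ht k).ne', add_sub_cancel]; exact hq k

/-- Adding the growth inequality to the subgradient inequality from `u` back to `x` cancels the
function values. -/
lemma QuadraticGrowth.exists_infDist_le {φ : F → EReal} (hbot : ∀ x, φ x ≠ ⊥) {x v : F}
    (hv : v ∈ subdifferential φ x) (hφ : QuadraticGrowth φ x v) :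
    ∃ c > (0 : ℝ), ∀ᶠ u in 𝓝 x, ∀ w ∈ subdifferential φ u,
      c * Metric.infDist u {z | v ∈ subdifferential φ z} ^ 2 ≤ ⟪w - v, u - x⟫_ℝ := by
  obtain ⟨c, hc, ε, hε, h⟩ := hφ
  refine ⟨c / 2, half_pos hc, ?_⟩
  filter_upwards [Metric.ball_mem_nhds x hε] with u hu w hw
  have hu := h u hu
  obtain ⟨r, hr⟩ := exists_real_of_mem_subdifferential hbot hv
  obtain ⟨s, hs⟩ := exists_real_of_mem_subdifferential hbot hw
  have h₂ := subgradient_inequality hw hs hr.le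
  rw [hr, hs] at hu
  have hu' := EReal.coe_le_coe_iff.1 ((EReal.coe_add _ _).trans_le hu)
  rw [← neg_sub u x, inner_neg_right] at h₂
  rw [inner_sub_left]
  linarith

/-- Under quadratic growth, a direction of the graph of the subdifferential whose two components
have nonpositive inner product is tangent to the set of points with the given subgradient. -/
lemma QuadraticGrowth.mem_tangentCone {φ : F → EReal} (hbot : ∀ x, φ x ≠ ⊥) {x v w h : F}
    (hv : v ∈ subdifferential φ x) (hφ : QuadraticGrowth φ x v) {t : ℕ → ℝ} {d e : ℕ → F}
    (ht : ∀ k, 0 < t k) (ht₀ : Tendsto t atTop (𝓝 0)) (hd : Tendsto d atTop (𝓝 w))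
    (he : Tendsto e atTop (𝓝 h)) (hmem : ∀ k, v + t k • e k ∈ subdifferential φ (x + t k • d k))
    (hwh : ⟪h, w⟫_ℝ ≤ 0) : w ∈ tangentCone {z | v ∈ subdifferential φ z} x := by
  obtain ⟨c, hc, hgrow⟩ := hφ.exists_infDist_le hbot hv
  have hlim : Tendsto (fun k => x + t k • d k) atTop (𝓝 x) := by
    simpa using tendsto_const_nhds.add (ht₀.smul hd)
  have hinner : Tendsto (fun k => c⁻¹ * ⟪e k, d k⟫_ℝ) atTop (𝓝 (c⁻¹ * ⟪h, w⟫_ℝ)) :=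
    (he.inner hd).const_mul _
  -- The growth estimate divided by `t k ^ 2`; its right side has a nonpositive limit, so the
  -- distance is `o(t k)`.
  have hle : ∀ᶠ k in atTop,
      (Metric.infDist (x + t k • d k) {z | v ∈ subdifferential φ z} / t k) ^ 2 ≤
        c⁻¹ * ⟪e k, d k⟫_ℝ := by
    filter_upwards [hlim.eventually hgrow] with k hk
    have := hk _ (hmem k)
    rw [add_sub_cancel_left, add_sub_cancel_left, real_inner_smul_left, real_inner_smul_right]
      at this
    rw [div_pow, div_le_iff₀ (pow_pos (ht k) 2), mul_assoc, ← div_eq_inv_mul, le_div_iff₀ hc]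
    linarith
  have hsq : Tendsto (fun k =>
      (Metric.infDist (x + t k • d k) {z | v ∈ subdifferential φ z} / t k) ^ 2) atTop (𝓝 0) := by
    have hzero : c⁻¹ * ⟪h, w⟫_ℝ = 0 := le_antisymm
      (mul_nonpos_of_nonneg_of_nonpos (inv_pos.2 hc).le hwh)
      (ge_of_tendsto hinner (hle.mono fun k hk => (sq_nonneg _).trans hk))
    exact squeeze_zero' (Eventually.of_forall fun _ => sq_nonneg _) hle (hzero ▸ hinner)
  refine mem_tangentCone_of_infDist ⟨x, hv⟩ ht ht₀ hd ?_
  have hsqrt := (Real.continuous_sqrt.tendsto 0).comp hsq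
  rw [Real.sqrt_zero] at hsqrt
  refine hsqrt.congr fun k => ?_
  exact Real.sqrt_sq (div_nonneg Metric.infDist_nonneg (ht k).le)

/-- The tangent cone to `∂φ(x)` at `v` is contained in the normal cone to `(∂φ)⁻¹(v)` at `x`. -/
lemma tangentCone_subset_normalCone {φ : F → EReal} (hbot : ∀ x, φ x ≠ ⊥) {x v : F} :
    tangentCone (subdifferential φ x) v ⊆ normalCone {z | v ∈ subdifferential φ z} x := by
  rintro w ⟨t, u, ht, -, hu, hmem⟩ z hz
  refine le_of_tendsto (hu.inner tendsto_const_nhds) (Eventually.of_forall fun k => ?_)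
  have h := monotone_subdifferential hbot (hmem k) hz
  rw [sub_add_cancel_left, inner_neg_left, real_inner_smul_left] at h
  exact nonpos_of_mul_nonpos_right (by linarith) (ht k)

end Tangents

/-! ### Sequential criterion for isolated calmness. -/

/-- Isolated calmness means that the graph has no nonzero direction over the zero direction of the
parameter. -/
theorem isolatedCalm_iff {P Z : Type*} [NormedAddCommGroup P] [NormedSpace ℝ P]
    [NormedAddCommGroup Z] [NormedSpace ℝ Z] [ProperSpace Z] {S : P → Set Z} {p : P} {z : Z}
    (hz : z ∈ S p) :
    IsolatedCalm S p z ↔ ∀ (t : ℕ → ℝ) (π : ℕ → P) (ζ : ℕ → Z) (ζ₀ : Z), (∀ k, 0 < t k) →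
      Tendsto t atTop (𝓝 0) → Tendsto π atTop (𝓝 0) → Tendsto ζ atTop (𝓝 ζ₀) →
      (∀ k, z + t k • ζ k ∈ S (p + t k • π k)) → ζ₀ = 0 := by
  constructor
  · rintro ⟨-, ℓ, -, U, hU, V, hV, h⟩ t π ζ ζ₀ ht ht₀ hπ hζ hmem
    have hp : Tendsto (fun k => p + t k • π k) atTop (𝓝 p) := by
      simpa using tendsto_const_nhds.add (ht₀.smul hπ)
    have hz' : Tendsto (fun k => z + t k • ζ k) atTop (𝓝 z) := by
      simpa using tendsto_const_nhds.add (ht₀.smul hζ)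
    have hle : ∀ᶠ k in atTop, ‖ζ k‖ ≤ ℓ * ‖π k‖ := by
      filter_upwards [hp hV, hz' hU] with k hkV hkU
      have := h _ hkV _ ⟨hmem k, hkU⟩
      rw [add_sub_cancel_left, add_sub_cancel_left, norm_smul, norm_smul,
        Real.norm_of_nonneg (ht k).le, mul_left_comm] at this
      exact le_of_mul_le_mul_left this (ht k)
    have := le_of_tendsto_of_tendsto hζ.norm (hπ.norm.const_mul ℓ) hle
    rw [norm_zero, mul_zero] at this
    exact norm_le_zero_iff.1 this
  · intro h
    by_contra hcalm
    have hex : ∀ k : ℕ, ∃ p' : P, ∃ z' ∈ S p', ‖z' - z‖ < 1 / ((k : ℝ) + 1) ∧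
        ((k : ℝ) + 1) * ‖p' - p‖ < ‖z' - z‖ := by
      intro k
      by_contra! hk
      -- The whole space serves as neighbourhood of `p`: violating the estimate already forces `p'`
      -- close to `p`.
      refine hcalm ⟨hz, (k : ℝ) + 1, by positivity, Metric.ball z (1 / ((k : ℝ) + 1)),
        Metric.ball_mem_nhds _ (by positivity), univ, univ_mem, fun p' _ z' hz' => ?_⟩
      exact hk p' z' hz'.1 (mem_ball_iff_norm.1 hz'.2)
    choose p' z' hmem hsmall hlt using hex
    -- This scaling puts the directions on the unit sphere, whose compactness yields a nonzero
    -- limit.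
    set t : ℕ → ℝ := fun k => ‖z' k - z‖ with ht
    have htpos : ∀ k, 0 < t k := fun k => lt_of_le_of_lt (by positivity) (hlt k)
    have ht₀ : Tendsto t atTop (𝓝 0) := squeeze_zero (fun k => (htpos k).le)
      (fun k => (hsmall k).le) tendsto_one_div_add_atTop_nhds_zero_nat
    have hπ : Tendsto (fun k => (t k)⁻¹ • (p' k - p)) atTop (𝓝 0) := by
      refine squeeze_zero_norm (fun k => ?_) (tendsto_one_div_add_atTop_nhds_zero_nat (𝕜 := ℝ))
      rw [norm_smul, Real.norm_of_nonneg (inv_pos.2 (htpos k)).le, inv_mul_le_iff₀ (htpos k),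
        mul_one_div, le_div_iff₀ (by positivity), mul_comm]
      exact (hlt k).le
    have hsphere : ∀ k, (t k)⁻¹ • (z' k - z) ∈ Metric.sphere (0 : Z) 1 := fun k => by
      rw [mem_sphere_zero_iff_norm, norm_smul, Real.norm_of_nonneg (inv_pos.2 (htpos k)).le]
      exact inv_mul_cancel₀ (htpos k).ne'
    obtain ⟨ζ₀, hζ₀, σ, hσ, hζ⟩ := (isCompact_sphere (0 : Z) 1).tendsto_subseq hsphere
    have hzero := h (t ∘ σ) _ _ ζ₀ (fun k => htpos _) (ht₀.comp hσ.tendsto_atTop)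
      (hπ.comp hσ.tendsto_atTop) hζ fun k => by
        simp only [Function.comp_apply]
        rw [smul_inv_smul₀ (htpos _).ne', smul_inv_smul₀ (htpos _).ne', add_sub_cancel,
          add_sub_cancel]
        exact hmem _
    rw [hzero, mem_sphere_zero_iff_norm, norm_zero] at hζ₀
    exact zero_ne_one hζ₀

/-! ### The least-squares system. -/

section LeastSquares

variable {X E F : Type*}
  [NormedAddCommGroup X] [InnerProductSpace ℝ X] [FiniteDimensional ℝ X]
  [NormedAddCommGroup E] [InnerProductSpace ℝ E] [FiniteDimensional ℝ E]
  [NormedAddCommGroup F] [InnerProductSpace ℝ F] [FiniteDimensional ℝ F]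

/-- The linearization of the optimality equation along a sequence. -/
lemma linearized_optimality (Φ : X →ₗ[ℝ] E) (K : X →ₗ[ℝ] F) {b : E} {μ : ℝ} (hμ : 0 < μ)
    {x w : X} {y h : F}
    (h₀ : 0 = LinearMap.adjoint K y + (1 / μ) • LinearMap.adjoint Φ (Φ x - b))
    {t m : ℕ → ℝ} {β : ℕ → E} {d : ℕ → X} {e : ℕ → F}
    (ht : ∀ k, 0 < t k) (ht₀ : Tendsto t atTop (𝓝 0)) (hm : Tendsto m atTop (𝓝 0))
    (hβ : Tendsto β atTop (𝓝 0)) (hd : Tendsto d atTop (𝓝 w)) (he : Tendsto e atTop (𝓝 h))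
    (hpos : ∀ k, 0 < μ + t k * m k)
    (hk : ∀ k, 0 = LinearMap.adjoint K (y + t k • e k) +
      (1 / (μ + t k * m k)) • LinearMap.adjoint Φ (Φ (x + t k • d k) - (b + t k • β k))) :
    μ • LinearMap.adjoint K h + LinearMap.adjoint Φ (Φ w) = 0 := by
  have hΦ₀ : LinearMap.adjoint Φ (Φ x - b) = -(μ • LinearMap.adjoint K y) := by
    have := congrArg (μ • ·) h₀
    simp only [smul_zero, smul_add, one_div, smul_inv_smul₀ hμ.ne'] at this
    exact (neg_eq_of_add_eq_zero_right this.symm).symm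
  -- Clear the denominator, subtract the unperturbed equation and divide by `t k`.
  have hzero : ∀ k, m k • LinearMap.adjoint K y + (μ + t k * m k) • LinearMap.adjoint K (e k) +
      LinearMap.adjoint Φ (Φ (d k) - β k) = 0 := by
    intro k
    have h₁ := congrArg ((μ + t k * m k) • ·) (hk k)
    simp only [smul_zero, smul_add, one_div, smul_inv_smul₀ (hpos k).ne'] at h₁
    have h₂ : Φ (x + t k • d k) - (b + t k • β k) = (Φ x - b) + t k • (Φ (d k) - β k) := by
      rw [map_add, map_smul]; module
    rw [h₂, map_add (LinearMap.adjoint Φ), hΦ₀, map_smul, map_add, map_smul] at h₁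
    refine (smul_eq_zero_iff_right (ht k).ne').1 (Eq.trans ?_ h₁.symm)
    module
  have hcK : Continuous (LinearMap.adjoint K) := LinearMap.continuous_of_finiteDimensional _
  have hcΦ : Continuous (LinearMap.adjoint Φ) := LinearMap.continuous_of_finiteDimensional _
  have hcΦ' : Continuous Φ := LinearMap.continuous_of_finiteDimensional _
  have hlim : Tendsto (fun k => m k • LinearMap.adjoint K y +
      (μ + t k * m k) • LinearMap.adjoint K (e k) + LinearMap.adjoint Φ (Φ (d k) - β k)) atTop
      (𝓝 ((0 : ℝ) • LinearMap.adjoint K y + (μ + 0 * 0) • LinearMap.adjoint K h +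
        LinearMap.adjoint Φ (Φ w - 0))) :=
    ((hm.smul_const _).add ((tendsto_const_nhds.add (ht₀.mul hm)).smul
      ((hcK.tendsto h).comp he))).add ((hcΦ.tendsto _).comp (((hcΦ'.tendsto w).comp hd).sub hβ))
  have := tendsto_nhds_unique (hlim.congr hzero) tendsto_const_nhds
  simpa using this

end LeastSquares

end PDCalm

theorem corollary4p10
    {X E F : Type*}
    [NormedAddCommGroup X] [InnerProductSpace ℝ X] [FiniteDimensional ℝ X]
    [NormedAddCommGroup E] [InnerProductSpace ℝ E] [FiniteDimensional ℝ E]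
    [NormedAddCommGroup F] [InnerProductSpace ℝ F] [FiniteDimensional ℝ F]
    (Φ : X →ₗ[ℝ] E) (K : X →ₗ[ℝ] F) (g : F → EReal)
    (hg_proper : PDCalm.IsProper g) (hg_lsc : LowerSemicontinuous g)
    (hg_convex : PDCalm.IsConvex g)
    (b : E) (μ : ℝ) (hμ : 0 < μ) (x : X) (y : F)
    (hxy : (x, y) ∈ PDCalm.primalDualSolution Φ K g (b, μ, 0))
    (hgrowth : PDCalm.PrimalDualQuadraticGrowth g (K x) y)
    (hcond :
      -- (i) `∂g*(y)` is polyhedral and the strict Robinson constraint qualification holds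
      (PDCalm.IsPolyhedral (PDCalm.subdifferential (PDCalm.conjugate g) y) ∧
        (LinearMap.ker (LinearMap.adjoint K) : Set F) ∩
          PDCalm.tangentCone (PDCalm.subdifferential g (K x)) y = {0}) ∨
      -- (ii) `Im K` meets `ri ∂g*(y)` and the strict Robinson constraint qualification holds
      (((LinearMap.range K : Set F) ∩
          intrinsicInterior ℝ (PDCalm.subdifferential (PDCalm.conjugate g) y)).Nonempty ∧
        (LinearMap.ker (LinearMap.adjoint K) : Set F) ∩
          PDCalm.tangentCone (PDCalm.subdifferential g (K x)) y = {0}) ∨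
      -- (iii) the normal cone to `∂g*(y)` at `K x` meets `Ker K*` only at `0`
      (LinearMap.ker (LinearMap.adjoint K) : Set F) ∩
        PDCalm.normalCone (PDCalm.subdifferential (PDCalm.conjugate g) y) (K x) = {0}) :
    PDCalm.IsolatedCalm (PDCalm.primalDualSolution Φ K g) (b, μ, 0) (x, y) ↔
      (LinearMap.ker Φ : Set X) ∩
        K ⁻¹' PDCalm.tangentCone (PDCalm.subdifferential (PDCalm.conjugate g) y) (K x) = {0} := by

  have hzS := hxy
  obtain ⟨-, h₀, s₀, hs₀, hv₀⟩ := hxy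
  have hdual : ∀ {s y : F}, s ∈ PDCalm.subdifferential (PDCalm.conjugate g) y ↔
      y ∈ PDCalm.subdifferential g s :=
    PDCalm.mem_subdifferential_conjugate_iff hg_proper hg_lsc hg_convex
  have hinv : {z | y ∈ PDCalm.subdifferential g z} =
      PDCalm.subdifferential (PDCalm.conjugate g) y := Set.ext fun _ => hdual.symm
  have hinv' : {z | K x ∈ PDCalm.subdifferential (PDCalm.conjugate g) z} =
      PDCalm.subdifferential g (K x) := Set.ext fun _ => hdual
  have hs₀K : s₀ = K x := by
    simp only at hv₀
    exact (neg_add_eq_zero.1 hv₀.symm).symm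
  rw [hs₀K] at hs₀
  have hy := hdual.1 hs₀
  -- The common consequence of the three conditions; under (iii) it follows since tangents to `∂g(K
  -- x)` are normals to `∂g*(y)`.
  have hSRCQ : ∀ h : F, LinearMap.adjoint K h = 0 →
      h ∈ PDCalm.tangentCone (PDCalm.subdifferential g (K x)) y → h = 0 := by
    intro h hK hT
    rcases hcond with ⟨-, hc⟩ | ⟨-, hc⟩ | hc
    · exact hc.subset ⟨hK, hT⟩
    · exact hc.subset ⟨hK, hT⟩
    · refine hc.subset ⟨hK, ?_⟩
      rw [← hinv]
      exact PDCalm.tangentCone_subset_normalCone hg_proper.1 hT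
  rw [PDCalm.isolatedCalm_iff hzS]
  constructor
  · intro hcalm
    refine Set.Subset.antisymm ?_ ?_
    · rintro w ⟨hΦ, t, u, ht, ht₀, hu, hmem⟩
      have hΦ : Φ w = 0 := hΦ
      have hlim : Tendsto (fun k => ((0, 0, u k - K w) : E × ℝ × F)) atTop (𝓝 0) := by
        have : Tendsto (fun k => u k - K w) atTop (𝓝 0) := by
          simpa using hu.sub (tendsto_const_nhds (x := K w))
        exact tendsto_const_nhds.prodMk_nhds (tendsto_const_nhds.prodMk_nhds this)
      -- Since `Φ w = 0`, the optimality equation persists at `x + t k • w` with `y`, `b`, `μ`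
      -- unchanged.
      have := hcalm t _ (fun _ => (w, 0)) (w, 0) ht ht₀ hlim tendsto_const_nhds fun k =>
        ⟨by simpa using hμ, by simpa [hΦ] using h₀, K x + t k • u k,
          by simpa using hmem k, by simp [sub_eq_neg_add]⟩
      exact congrArg Prod.fst this
    · rintro _ rfl
      refine ⟨map_zero Φ, ?_⟩
      rw [Set.mem_preimage, map_zero]
      exact PDCalm.zero_mem_tangentCone hs₀
  · rintro hker t π ζ ⟨w, h⟩ ht ht₀ hπ hζ hmem
    have hd : Tendsto (fun k => (ζ k).1) atTop (𝓝 w) := hζ.fst_nhds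
    have he : Tendsto (fun k => (ζ k).2) atTop (𝓝 h) := hζ.snd_nhds
    have hlin := PDCalm.linearized_optimality Φ K hμ h₀ ht ht₀ hπ.snd_nhds.fst_nhds
      hπ.fst_nhds hd he (fun k => (hmem k).1) fun k => (hmem k).2.1
    have hinner : μ * ⟪h, K w⟫_ℝ + ‖Φ w‖ ^ 2 = 0 := by
      have := congrArg (fun q => ⟪q, w⟫_ℝ) hlin
      simpa only [inner_add_left, real_inner_smul_left, LinearMap.adjoint_inner_left,
        real_inner_self_eq_norm_sq, inner_zero_left] using this
    have hhw : ⟪h, K w⟫_ℝ ≤ 0 := by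
      by_contra! hneg
      have := mul_pos hμ hneg
      linarith [sq_nonneg ‖Φ w‖]
    have hKd : Tendsto (fun k => K (ζ k).1 + (π k).2.2) atTop (𝓝 (K w)) := by
      have hcK : Continuous K := LinearMap.continuous_of_finiteDimensional _
      simpa using ((hcK.tendsto w).comp hd).add hπ.snd_nhds.snd_nhds
    have hgraph : ∀ k, K x + t k • (K (ζ k).1 + (π k).2.2) ∈
        PDCalm.subdifferential (PDCalm.conjugate g) (y + t k • (ζ k).2) := by
      intro k
      obtain ⟨-, -, s, hs, hsv⟩ := hmem k
      have : s = K x + t k • (K (ζ k).1 + (π k).2.2) := by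
        simp only [Prod.snd_add, Prod.smul_snd, Prod.fst_add, Prod.smul_fst, map_add, map_smul,
          zero_add] at hsv
        rw [smul_add, hsv]; abel
      exact this ▸ hs
    -- One graph sequence, read through `∂g` and then through its inverse `∂g*`, gives both
    -- tangencies.
    have hTw := hgrowth.1.mem_tangentCone hg_proper.1 hy ht ht₀ hKd he
      (fun k => hdual.1 (hgraph k)) hhw
    have hTh := hgrowth.2.mem_tangentCone (PDCalm.conjugate_ne_bot hg_proper) hs₀ ht ht₀ he hKd
      hgraph (by rwa [real_inner_comm])
    rw [hinv] at hTw
    rw [hinv'] at hTh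
    have hnonneg : 0 ≤ ⟪h, K w⟫_ℝ := by
      refine ge_of_tendsto (he.inner hKd) (Eventually.of_forall fun k => ?_)
      have := PDCalm.monotone_subdifferential hg_proper.1 hy (hdual.1 (hgraph k))
      rw [add_sub_cancel_left, add_sub_cancel_left, real_inner_smul_left,
        real_inner_smul_right] at this
      exact nonneg_of_mul_nonneg_right (nonneg_of_mul_nonneg_right this (ht k)) (ht k)
    have hΦw : Φ w = 0 := by
      have := mul_nonneg hμ.le hnonneg
      exact norm_eq_zero.1 (pow_eq_zero_iff two_ne_zero |>.1
        (le_antisymm (by linarith) (sq_nonneg _)))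
    have hKh : LinearMap.adjoint K h = 0 := by
      rw [hΦw, map_zero, add_zero] at hlin
      exact (smul_eq_zero_iff_right hμ.ne').1 hlin
    have hw : w = 0 := hker.subset ⟨hΦw, hTw⟩
    rw [hw, hSRCQ h hKh hTh]
    rfl
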